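/- Let $SO(3)$ be the group of real $3\times 3$ matrices $R$ with $R^TR=RR^T=\mathbb I_3$ and $\det R=1$, with its usual topology as a subspace of the $3\times3$ matrices. For real numbers $\lambda_1\ge\lambda_2\ge\lambda_3>0$ put $D=\operatorname{diag}(\lambda_1,\lambda_2,\lambda_3)$ and consider the reduced free energy $$W_{1,0}(\,\cdot\,;D):SO(3)\to\mathbb R,\qquad W_{1,0}(R;D)=\bigl\|\operatorname{sym}(R^TD-\mathbb I_3)\bigr\|^2,$$ where $\operatorname{sym}(X)=\tfrac12(X+X^T)$ and $\|X\|^2=\operatorname{tr}(X^TX)$. (i) For all $\lambda_1\ge\lambda_2\ge\lambda_3>0$ (coincidences allowed), every local minimum of $W_{1,0}(\,\cdot\,;D)$ on $SO(3)$ is a global minimum. (ii) On the other hand, there are $\lambda_1\ge\lambda_2\ge\lambda_3>0$ for which $W_{1,0}(\,\cdot\,;D)$ has a local maximum on $SO(3)$ that is not a global maximum. More precisely, if $\lambda_1>\lambda_2>\lambda_3>0$, then $R$ is a local maximum and not a global maximum of $W_{1,0}(\,\cdot\,;D)$ in each of the following cases: $R=\mathbb I_3$ and $\lambda_2+\lambda_3>2$;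 $R=\operatorname{diag}(1,-1,-1)$ and $\lambda_1-\lambda_2>2$; $R=\operatorname{diag}(-1,1,-1)$ and $\lambda_2-\lambda_3>2$. -/

import Mathlib

namespace Cosserat

open Matrix

/-- Symmetric part `(X + Xᵀ) / 2` of a real square matrix. -/
noncomputable def symPart {n : ℕ} (X : Matrix (Fin n) (Fin n) ℝ) : Matrix (Fin n) (Fin n) ℝ :=
  (1 / 2 : ℝ) • (X + Xᵀ)

/-- Skew-symmetric part `(X - Xᵀ) / 2` of a real square matrix. -/
noncomputable def skewPart {n : ℕ} (X : Matrix (Fin n) (Fin n) ℝ) : Matrix (Fin n) (Fin n) ℝ :=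
  (1 / 2 : ℝ) • (X - Xᵀ)

/-- Squared Frobenius norm `‖X‖² = tr (Xᵀ X)`. -/
def frobSq {n : ℕ} (X : Matrix (Fin n) (Fin n) ℝ) : ℝ :=
  (Xᵀ * X).trace

/-- The free energy
`W_{μ,μc}(R; F) = μ ‖sym (Rᵀ F - 1)‖² + μc ‖skew (Rᵀ F - 1)‖²` on `SO(n)`. -/
noncomputable def freeEnergy {n : ℕ} (μ μc : ℝ) (F : Matrix (Fin n) (Fin n) ℝ)
    (R : specialOrthogonalGroup (Fin n) ℝ) : ℝ :=
  μ * frobSq (symPart ((R : Matrix (Fin n) (Fin n) ℝ)ᵀ * F - 1)) +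
    μc * frobSq (skewPart ((R : Matrix (Fin n) (Fin n) ℝ)ᵀ * F - 1))

/-- The reduced free energy `W_{1,0}(· ; D)` on `SO(3)`, where `D = diag(l₁, l₂, l₃)`. -/
noncomputable def reducedEnergy (l₁ l₂ l₃ : ℝ) (R : specialOrthogonalGroup (Fin 3) ℝ) : ℝ :=
  freeEnergy 1 0 (diagonal ![l₁, l₂, l₃]) R

/-- `x` is a local maximum of `f` (for the topology of the domain) and not a global maximum. -/
def IsNonglobalLocalMax {X : Type*} [TopologicalSpace X] (f : X → ℝ) (x : X) : Prop :=
  IsLocalMax f x ∧ ¬ ∀ y, f y ≤ f x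

end Cosserat

namespace Cosserat

open Matrix Filter Topology

/-! The cofactor identities make the energy a convex quadratic function of the diagonal of `R`
alone: half the square of a linear form plus an affine form. The diagonals fill a tetrahedron with
vertices `(1, 1, 1)`, `(1, -1, -1)`, `(-1, 1, -1)`, `(-1, -1, 1)`, whose barycentric coordinates are
the squared components of a unit quaternion of `R`. Segments in the tetrahedron lift to paths in
`SO(3)` from any chosen start (`exists_path_diagonal_segment`), so convexity rules out nonglobal
local minima. At a vertex, negative slopes along the three edges force a local maximum
(`isLocalMax_reducedEnergy_of_diagonal`), although another vertex may have larger energy. -/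

/-- Every entry of a rotation equals its cofactor, and its rows and columns are orthonormal. -/
structure RotationRelations (A : Matrix (Fin 3) (Fin 3) ℝ) : Prop where
  row00 : A 0 0 * A 0 0 + A 0 1 * A 0 1 + A 0 2 * A 0 2 = 1
  row11 : A 1 0 * A 1 0 + A 1 1 * A 1 1 + A 1 2 * A 1 2 = 1
  row22 : A 2 0 * A 2 0 + A 2 1 * A 2 1 + A 2 2 * A 2 2 = 1
  row01 : A 0 0 * A 1 0 + A 0 1 * A 1 1 + A 0 2 * A 1 2 = 0
  row02 : A 0 0 * A 2 0 + A 0 1 * A 2 1 + A 0 2 * A 2 2 = 0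
  row12 : A 1 0 * A 2 0 + A 1 1 * A 2 1 + A 1 2 * A 2 2 = 0
  col00 : A 0 0 * A 0 0 + A 1 0 * A 1 0 + A 2 0 * A 2 0 = 1
  col11 : A 0 1 * A 0 1 + A 1 1 * A 1 1 + A 2 1 * A 2 1 = 1
  col22 : A 0 2 * A 0 2 + A 1 2 * A 1 2 + A 2 2 * A 2 2 = 1
  col01 : A 0 0 * A 0 1 + A 1 0 * A 1 1 + A 2 0 * A 2 1 = 0
  col02 : A 0 0 * A 0 2 + A 1 0 * A 1 2 + A 2 0 * A 2 2 = 0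
  col12 : A 0 1 * A 0 2 + A 1 1 * A 1 2 + A 2 1 * A 2 2 = 0
  cof00 : A 0 0 = A 1 1 * A 2 2 - A 1 2 * A 2 1
  cof01 : A 0 1 = A 1 2 * A 2 0 - A 1 0 * A 2 2
  cof02 : A 0 2 = A 1 0 * A 2 1 - A 1 1 * A 2 0
  cof10 : A 1 0 = A 0 2 * A 2 1 - A 0 1 * A 2 2
  cof11 : A 1 1 = A 0 0 * A 2 2 - A 0 2 * A 2 0
  cof12 : A 1 2 = A 0 1 * A 2 0 - A 0 0 * A 2 1
  cof20 : A 2 0 = A 0 1 * A 1 2 - A 0 2 * A 1 1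
  cof21 : A 2 1 = A 0 2 * A 1 0 - A 0 0 * A 1 2
  cof22 : A 2 2 = A 0 0 * A 1 1 - A 0 1 * A 1 0

lemma rotationRelations {A : Matrix (Fin 3) (Fin 3) ℝ}
    (hA : A ∈ specialOrthogonalGroup (Fin 3) ℝ) : RotationRelations A := by
  obtain ⟨ho, hdet⟩ := mem_specialOrthogonalGroup_iff.1 hA
  have hrow : A * Aᵀ = 1 := (mem_orthogonalGroup_iff (Fin 3) ℝ).1 ho
  have hcol : Aᵀ * A = 1 := (mem_orthogonalGroup_iff' (Fin 3) ℝ).1 ho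
  have hadj : A.adjugate = Aᵀ := by
    calc A.adjugate = (Aᵀ * A) * A.adjugate := by rw [hcol, one_mul]
      _ = Aᵀ := by rw [Matrix.mul_assoc, mul_adjugate, hdet, one_smul, mul_one]
  have r i j := congrFun (congrFun hrow i) j
  have c i j := congrFun (congrFun hcol i) j
  have a i j := congrFun (congrFun hadj i) j
  simp only [mul_apply, transpose_apply, Fin.sum_univ_three, one_apply] at r c
  simp only [adjugate_fin_three, transpose_apply] at a
  have a00 := a 0 0
  have a01 := a 0 1
  have a02 := a 0 2
  have a10 := a 1 0
  have a11 := a 1 1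
  have a12 := a 1 2
  have a20 := a 2 0
  have a21 := a 2 1
  have a22 := a 2 2
  simp at a00 a01 a02 a10 a11 a12 a20 a21 a22
  exact
    { row00 := by simpa using r 0 0
      row11 := by simpa using r 1 1
      row22 := by simpa using r 2 2
      row01 := by simpa using r 0 1
      row02 := by simpa using r 0 2
      row12 := by simpa using r 1 2
      col00 := by simpa using c 0 0
      col11 := by simpa using c 1 1
      col22 := by simpa using c 2 2
      col01 := by simpa using c 0 1
      col02 := by simpa using c 0 2
      col12 := by simpa using c 1 2
      cof00 := by linarith
      cof01 := by linarith
      cof02 := by linarith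
      cof10 := by linarith
      cof11 := by linarith
      cof12 := by linarith
      cof20 := by linarith
      cof21 := by linarith
      cof22 := by linarith }

/-- The reduced energy as a function of the diagonal `(x, y, z)` of the rotation. -/
noncomputable def diagonalEnergy (l₁ l₂ l₃ x y z : ℝ) : ℝ :=
  (l₁ ^ 2 + l₂ ^ 2 + l₃ ^ 2) / 2 + 3 + (l₁ * x + l₂ * y + l₃ * z) ^ 2 / 2
    - (l₂ * l₃ + 2 * l₁) * x - (l₁ * l₃ + 2 * l₂) * y - (l₁ * l₂ + 2 * l₃) * z

/-- The expansion contains off-diagonal entries only in row norms, which are 1, and in products such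
as `A 0 1 * A 1 0`, which the cofactor identities express through the diagonal. -/
lemma reducedEnergy_eq_diagonalEnergy (l₁ l₂ l₃ : ℝ) (R : specialOrthogonalGroup (Fin 3) ℝ) :
    reducedEnergy l₁ l₂ l₃ R = diagonalEnergy l₁ l₂ l₃ (R.1 0 0) (R.1 1 1) (R.1 2 2) := by
  obtain ⟨A, hA⟩ := R
  have h := rotationRelations hA
  simp [reducedEnergy, freeEnergy, frobSq, symPart, diagonalEnergy, trace, mul_apply,
    Fin.sum_univ_three, one_apply, diagonal_apply]
  linear_combination l₁ ^ 2 / 2 * h.row00 + l₂ ^ 2 / 2 * h.row11 + l₃ ^ 2 / 2 * h.row22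
    + l₂ * l₃ * h.cof00 + l₁ * l₃ * h.cof11 + l₁ * l₂ * h.cof22

/-! ### Unit quaternions and the tetrahedron of diagonals -/

/-- The rotation matrix of a quaternion `(w, x, y, z)`. -/
def quaternionMatrix (q : Fin 4 → ℝ) : Matrix (Fin 3) (Fin 3) ℝ :=
  !![q 0 ^ 2 + q 1 ^ 2 - q 2 ^ 2 - q 3 ^ 2, 2 * (q 1 * q 2 - q 0 * q 3),
      2 * (q 1 * q 3 + q 0 * q 2);
    2 * (q 1 * q 2 + q 0 * q 3), q 0 ^ 2 - q 1 ^ 2 + q 2 ^ 2 - q 3 ^ 2,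
      2 * (q 2 * q 3 - q 0 * q 1);
    2 * (q 1 * q 3 - q 0 * q 2), 2 * (q 2 * q 3 + q 0 * q 1),
      q 0 ^ 2 - q 1 ^ 2 - q 2 ^ 2 + q 3 ^ 2]

lemma quaternionMatrix_mem {q : Fin 4 → ℝ} (hq : ∑ i, q i ^ 2 = 1) :
    quaternionMatrix q ∈ specialOrthogonalGroup (Fin 3) ℝ := by
  rw [Fin.sum_univ_four] at hq
  have h0 : q 0 ^ 2 = 1 - q 1 ^ 2 - q 2 ^ 2 - q 3 ^ 2 := by linarith
  rw [mem_specialOrthogonalGroup_iff, mem_orthogonalGroup_iff]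
  constructor
  · ext i j
    fin_cases i <;> fin_cases j <;>
      simp [quaternionMatrix, mul_apply, Fin.sum_univ_three] <;> grind
  · simp [quaternionMatrix, det_fin_three]
    grind

lemma continuous_quaternionMatrix : Continuous quaternionMatrix := by
  refine continuous_matrix fun i j => ?_
  fin_cases i <;> fin_cases j <;> simp [quaternionMatrix] <;> fun_prop

/-- The symmetric matrix `4 q qᵀ` of a rotation with unit quaternion `q`. -/
def quaternionGram (A : Matrix (Fin 3) (Fin 3) ℝ) : Matrix (Fin 4) (Fin 4) ℝ :=
  !![1 + A 0 0 + A 1 1 + A 2 2, A 2 1 - A 1 2, A 0 2 - A 2 0, A 1 0 - A 0 1;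
    A 2 1 - A 1 2, 1 + A 0 0 - A 1 1 - A 2 2, A 1 0 + A 0 1, A 0 2 + A 2 0;
    A 0 2 - A 2 0, A 1 0 + A 0 1, 1 - A 0 0 + A 1 1 - A 2 2, A 2 1 + A 1 2;
    A 1 0 - A 0 1, A 0 2 + A 2 0, A 2 1 + A 1 2, 1 - A 0 0 - A 1 1 + A 2 2]

lemma quaternionGram_mul {A : Matrix (Fin 3) (Fin 3) ℝ}
    (hA : A ∈ specialOrthogonalGroup (Fin 3) ℝ) (i j k : Fin 4) :
    quaternionGram A i i * quaternionGram A j k =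
      quaternionGram A i j * quaternionGram A i k := by
  obtain ⟨h1, h2, h3, h4, h5, h6, h7, h8, h9, h10, h11, h12,
    c1, c2, c3, c4, c5, c6, c7, c8, c9⟩ := rotationRelations hA
  fin_cases i <;> fin_cases j <;> fin_cases k <;> simp [quaternionGram] <;> linarith

lemma quaternionGram_trace (A : Matrix (Fin 3) (Fin 3) ℝ) :
    ∑ i, quaternionGram A i i = 4 := by
  simp [quaternionGram, Fin.sum_univ_four]
  ring

/-- Rank one and trace 4 make each diagonal entry a quarter of a sum of squares. These four
inequalities are the faces of the tetrahedron. -/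
lemma quaternionGram_diag_nonneg {A : Matrix (Fin 3) (Fin 3) ℝ}
    (hA : A ∈ specialOrthogonalGroup (Fin 3) ℝ) (i : Fin 4) : 0 ≤ quaternionGram A i i := by
  have h : quaternionGram A i i * 4 = ∑ j, quaternionGram A i j ^ 2 := by
    rw [← quaternionGram_trace A, Finset.mul_sum]
    exact Finset.sum_congr rfl fun j _ => by rw [quaternionGram_mul hA, sq]
  have := Finset.sum_nonneg fun j (_ : j ∈ Finset.univ) => sq_nonneg (quaternionGram A i j)
  linarith

lemma exists_quaternion {A : Matrix (Fin 3) (Fin 3) ℝ}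
    (hA : A ∈ specialOrthogonalGroup (Fin 3) ℝ) :
    ∃ q : Fin 4 → ℝ, ∑ i, q i ^ 2 = 1 ∧ quaternionMatrix q = A := by
  obtain ⟨i, hi⟩ : ∃ i, 0 < quaternionGram A i i := by
    by_contra! h
    have := Finset.sum_nonpos fun i (_ : i ∈ Finset.univ) => h i
    rw [quaternionGram_trace] at this
    linarith
  have hs : √(quaternionGram A i i) ^ 2 = quaternionGram A i i := Real.sq_sqrt hi.le
  have hs0 : √(quaternionGram A i i) ≠ 0 := (Real.sqrt_pos.2 hi).ne'
  obtain ⟨q, hq⟩ : ∃ q : Fin 4 → ℝ, ∀ j k, q j * q k = quaternionGram A j k / 4 := by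
    -- Row `i` of `4 q qᵀ` is `4 (q i) q`, and the diagonal entry gives `2 |q i|`; dividing recovers
    -- `q` up to sign.
    refine ⟨fun j => quaternionGram A i j / (2 * √(quaternionGram A i i)), fun j k => ?_⟩
    have h := quaternionGram_mul hA i j k
    rw [← hs] at h
    field_simp
    linarith
  refine ⟨q, ?_, ?_⟩
  · simp_rw [sq, hq, ← Finset.sum_div, quaternionGram_trace]
    norm_num
  · ext a b
    fin_cases a <;> fin_cases b <;>
      simp [quaternionMatrix, sq, hq, quaternionGram] <;> ring

/-- Lift to the sphere, starting at `q`, of the segment from `q²` to `r²` in the simplex. -/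
noncomputable def simplexLift (q r : Fin 4 → ℝ) (t : ℝ) (i : Fin 4) : ℝ :=
  (if 0 ≤ q i then 1 else -1) * √((1 - t) * q i ^ 2 + t * r i ^ 2)

/-- Keeping the signs of `q` makes the path start at `q` itself, not merely at a quaternion with the
same squares. Where `q i = 0` either sign would do. -/
lemma simplexLift_zero (q r : Fin 4 → ℝ) : simplexLift q r 0 = q := by
  ext i
  by_cases h : 0 ≤ q i
  · simp [simplexLift, h, Real.sqrt_sq]
  · simp [simplexLift, h, Real.sqrt_sq_eq_abs, abs_of_neg (not_le.1 h)]

lemma simplexLift_sq (q r : Fin 4 → ℝ) {t : ℝ} (ht : t ∈ Set.Icc (0 : ℝ) 1) (i : Fin 4) :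
    simplexLift q r t i ^ 2 = (1 - t) * q i ^ 2 + t * r i ^ 2 := by
  have h : 0 ≤ (1 - t) * q i ^ 2 + t * r i ^ 2 :=
    add_nonneg (mul_nonneg (by linarith [ht.2]) (sq_nonneg _))
      (mul_nonneg ht.1 (sq_nonneg _))
  rw [simplexLift, mul_pow, Real.sq_sqrt h]
  split_ifs <;> simp

lemma continuous_simplexLift (q r : Fin 4 → ℝ) : Continuous (simplexLift q r) := by
  refine continuous_pi fun i => ?_
  unfold simplexLift
  fun_prop

/-- Any two rotations are joined by a path along which the diagonal moves on a segment. -/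
lemma exists_path_diagonal_segment (R S : specialOrthogonalGroup (Fin 3) ℝ) :
    ∃ γ : unitInterval → specialOrthogonalGroup (Fin 3) ℝ, Continuous γ ∧ γ 0 = R ∧
      ∀ t i, (γ t).1 i i = (1 - t) * R.1 i i + t * S.1 i i := by
  obtain ⟨q, hq, hqR⟩ := exists_quaternion R.2
  obtain ⟨r, hr, hrS⟩ := exists_quaternion S.2
  have hmem (t : unitInterval) : ∑ i, simplexLift q r t i ^ 2 = 1 := by
    simp_rw [simplexLift_sq q r t.2]
    rw [Finset.sum_add_distrib, ← Finset.mul_sum, ← Finset.mul_sum, hq, hr]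
    ring
  refine ⟨fun t => ⟨quaternionMatrix (simplexLift q r t), quaternionMatrix_mem (hmem t)⟩,
    ?_, ?_, fun t i => ?_⟩
  · exact (continuous_quaternionMatrix.comp
      ((continuous_simplexLift q r).comp continuous_subtype_val)).subtype_mk _
  · ext1
    simpa [simplexLift_zero] using hqR
  · rw [← hqR, ← hrS]
    fin_cases i <;> simp [quaternionMatrix, simplexLift_sq q r t.2] <;> ring

theorem reducedEnergy_le_of_isLocalMin {l₁ l₂ l₃ : ℝ} {R : specialOrthogonalGroup (Fin 3) ℝ}
    (hR : IsLocalMin (reducedEnergy l₁ l₂ l₃) R) (S : specialOrthogonalGroup (Fin 3) ℝ) :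
    reducedEnergy l₁ l₂ l₃ R ≤ reducedEnergy l₁ l₂ l₃ S := by
  obtain ⟨γ, hγ, hγ0, hdiag⟩ := exists_path_diagonal_segment R S
  have hconv (t : unitInterval) : reducedEnergy l₁ l₂ l₃ (γ t) ≤
      (1 - t) * reducedEnergy l₁ l₂ l₃ R + t * reducedEnergy l₁ l₂ l₃ S := by
    simp only [reducedEnergy_eq_diagonalEnergy, hdiag, diagonalEnergy]
    have h1 : 0 ≤ (t : ℝ) * (1 - t) := mul_nonneg t.2.1 (by linarith [t.2.2])
    have h2 := mul_nonneg h1 (sq_nonneg (l₁ * (R.1 0 0 - S.1 0 0) +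
      l₂ * (R.1 1 1 - S.1 1 1) + l₃ * (R.1 2 2 - S.1 2 2)))
    -- The convexity defect comes from the squared linear form only.
    linear_combination h2 / 2
  have hev : ∀ᶠ t in 𝓝 (0 : unitInterval),
      reducedEnergy l₁ l₂ l₃ R ≤ reducedEnergy l₁ l₂ l₃ (γ t) := by
    have h : Tendsto γ (𝓝 0) (𝓝 R) := hγ0 ▸ hγ.tendsto 0
    exact h.eventually hR
  have : (𝓝[>] (0 : unitInterval)).NeBot := nhdsGT_neBot_of_exists_gt ⟨1, zero_lt_one⟩
  obtain ⟨t, ht, ht0⟩ := ((hev.filter_mono nhdsWithin_le_nhds).and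
    (self_mem_nhdsWithin : Set.Ioi (0 : unitInterval) ∈ 𝓝[>] 0)).exists
  have ht0 : (0 : ℝ) < t := ht0
  have h : 0 ≤ (t : ℝ) * (reducedEnergy l₁ l₂ l₃ S - reducedEnergy l₁ l₂ l₃ R) := by
    linarith [hconv t]
  linarith [(mul_nonneg_iff_of_pos_left ht0).1 h]

/-! ### Local maxima at the vertices -/

/-- A diagonal rotation is a local maximum if the energy decreases along the three edges of the
tetrahedron of diagonals which leave it. -/
theorem isLocalMax_reducedEnergy_of_diagonal {l₁ l₂ l₃ e₁ e₂ e₃ : ℝ}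
    {R : specialOrthogonalGroup (Fin 3) ℝ}
    (hR : (R : Matrix (Fin 3) (Fin 3) ℝ) = diagonal ![e₁, e₂, e₃])
    (h₁ : (e₂ * l₂ + e₃ * l₃) * (2 - (e₂ * l₂ + e₃ * l₃)) < 0)
    (h₂ : (e₁ * l₁ + e₃ * l₃) * (2 - (e₁ * l₁ + e₃ * l₃)) < 0)
    (h₃ : (e₁ * l₁ + e₂ * l₂) * (2 - (e₁ * l₁ + e₂ * l₂)) < 0) :
    IsLocalMax (reducedEnergy l₁ l₂ l₃) R := by
  have hrel := rotationRelations R.2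
  have d0 : R.1 0 0 = e₁ := by simp [hR]
  have d1 : R.1 1 1 = e₂ := by simp [hR]
  have d2 : R.1 2 2 = e₃ := by simp [hR]
  have s1 : e₁ = 1 ∨ e₁ = -1 := mul_self_eq_one_iff.1 (by simpa [hR] using hrel.row00)
  have s2 : e₂ = 1 ∨ e₂ = -1 := mul_self_eq_one_iff.1 (by simpa [hR] using hrel.row11)
  have s3 : e₃ = e₁ * e₂ := by simpa [hR] using hrel.cof22
  let u (S : specialOrthogonalGroup (Fin 3) ℝ) : ℝ :=
    l₁ * (S.1 0 0 - e₁) + l₂ * (S.1 1 1 - e₂) + l₃ * (S.1 2 2 - e₃)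
  have hu : Continuous u := by
    have hc (i : Fin 3) : Continuous fun S : specialOrthogonalGroup (Fin 3) ℝ => S.1 i i :=
      (continuous_subtype_val : Continuous fun S : specialOrthogonalGroup (Fin 3) ℝ =>
        (S.1 : Matrix (Fin 3) (Fin 3) ℝ)).matrix_elem i i
    exact (((hc 0).sub continuous_const).const_mul l₁).add
      (((hc 1).sub continuous_const).const_mul l₂) |>.add
      (((hc 2).sub continuous_const).const_mul l₃)
  have hu0 : u R = 0 := by simp [u, d0, d1, d2]
  -- Since `u` vanishes at `R`, the sign of the edge slope persists nearby.
  have hsmall {m : ℝ} (hm : m * (2 - m) < 0) : ∀ᶠ S in 𝓝 R, m * (2 * (2 - m) - u S) < 0 := by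
    have hc : Continuous fun S => m * (2 * (2 - m) - u S) := by fun_prop
    exact hc.continuousAt.eventually_lt continuousAt_const (by rw [hu0]; linarith)
  filter_upwards [hsmall h₁, hsmall h₂, hsmall h₃] with S g₁ g₂ g₃
  have k0 := quaternionGram_diag_nonneg S.2 0
  have k1 := quaternionGram_diag_nonneg S.2 1
  have k2 := quaternionGram_diag_nonneg S.2 2
  have k3 := quaternionGram_diag_nonneg S.2 3
  simp [quaternionGram] at k0 k1 k2 k3
  -- Four times the barycentric coordinates of `S` at the other three vertices.
  have p₁ : 0 ≤ 1 + e₁ * S.1 0 0 - e₂ * S.1 1 1 - e₃ * S.1 2 2 := by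
    rcases s1 with rfl | rfl <;> rcases s2 with rfl | rfl <;> subst s3 <;> linarith
  have p₂ : 0 ≤ 1 - e₁ * S.1 0 0 + e₂ * S.1 1 1 - e₃ * S.1 2 2 := by
    rcases s1 with rfl | rfl <;> rcases s2 with rfl | rfl <;> subst s3 <;> linarith
  have p₃ : 0 ≤ 1 - e₁ * S.1 0 0 - e₂ * S.1 1 1 + e₃ * S.1 2 2 := by
    rcases s1 with rfl | rfl <;> rcases s2 with rfl | rfl <;> subst s3 <;> linarith
  have q₁ := mul_nonpos_of_nonneg_of_nonpos p₁ g₁.le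
  have q₂ := mul_nonpos_of_nonneg_of_nonpos p₂ g₂.le
  have q₃ := mul_nonpos_of_nonneg_of_nonpos p₃ g₃.le
  simp only [u] at q₁ q₂ q₃
  rw [reducedEnergy_eq_diagonalEnergy, reducedEnergy_eq_diagonalEnergy, d0, d1, d2]
  unfold diagonalEnergy
  -- With `mᵢ` the edge sums in the hypotheses, `u = -∑ pᵢ mᵢ / 2`. The energy change is thus
  -- exactly `∑ pᵢ mᵢ (2 (2 - mᵢ) - u) / 4`.
  rcases s1 with rfl | rfl <;> rcases s2 with rfl | rfl <;> subst s3 <;>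
    linear_combination (q₁ + q₂ + q₃) / 4

lemma diagonal_mem_specialOrthogonalGroup :
    diagonal ![(-1 : ℝ), -1, 1] ∈ specialOrthogonalGroup (Fin 3) ℝ := by
  rw [mem_specialOrthogonalGroup_iff, mem_orthogonalGroup_iff]
  constructor
  · ext i j
    fin_cases i <;> fin_cases j <;> simp [mul_apply, Fin.sum_univ_three]
  · simp [Fin.prod_univ_three]

theorem isNonglobalLocalMax_reducedEnergy {l₁ l₂ l₃ : ℝ} (h₁₂ : l₁ > l₂) (h₂₃ : l₂ > l₃)
    (h₃ : l₃ > 0) {R : specialOrthogonalGroup (Fin 3) ℝ}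
    (hR : (R : Matrix (Fin 3) (Fin 3) ℝ) = 1 ∧ l₂ + l₃ > 2 ∨
      (R : Matrix (Fin 3) (Fin 3) ℝ) = diagonal ![1, -1, -1] ∧ l₁ - l₂ > 2 ∨
      (R : Matrix (Fin 3) (Fin 3) ℝ) = diagonal ![-1, 1, -1] ∧ l₂ - l₃ > 2) :
    IsNonglobalLocalMax (reducedEnergy l₁ l₂ l₃) R := by
  have hbig {m : ℝ} (hm : 2 < m) : m * (2 - m) < 0 :=
    mul_neg_of_pos_of_neg (by linarith) (by linarith)
  have hneg {m : ℝ} (hm : m < 0) : m * (2 - m) < 0 :=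
    mul_neg_of_neg_of_pos hm (by linarith)
  -- The vertex of largest energy: it exceeds the three candidates by `4 (l₁ + l₂)`, `4 (l₁ - l₃)`
  -- and `4 (l₂ - l₃)` respectively.
  let T : specialOrthogonalGroup (Fin 3) ℝ := ⟨_, diagonal_mem_specialOrthogonalGroup⟩
  rcases hR with ⟨hR, h⟩ | ⟨hR, h⟩ | ⟨hR, h⟩
  · have hR' : (R : Matrix (Fin 3) (Fin 3) ℝ) = diagonal ![1, 1, 1] := by
      rw [hR]
      ext i j
      fin_cases i <;> fin_cases j <;> simp
    refine ⟨isLocalMax_reducedEnergy_of_diagonal hR' (hbig (by linarith)) (hbig (by linarith))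
      (hbig (by linarith)), fun hmax => ?_⟩
    have := hmax T
    simp [reducedEnergy_eq_diagonalEnergy, T, hR, diagonalEnergy] at this
    nlinarith
  · refine ⟨isLocalMax_reducedEnergy_of_diagonal hR (hneg (by linarith)) (hbig (by linarith))
      (hbig (by linarith)), fun hmax => ?_⟩
    have := hmax T
    simp [reducedEnergy_eq_diagonalEnergy, T, hR, diagonalEnergy] at this
    nlinarith
  · refine ⟨isLocalMax_reducedEnergy_of_diagonal hR (hbig (by linarith)) (hneg (by linarith))
      (hneg (by linarith)), fun hmax => ?_⟩
    have := hmax T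
    simp [reducedEnergy_eq_diagonalEnergy, T, hR, diagonalEnergy] at this
    nlinarith

end Cosserat

theorem mainTheorem9 :
    (∀ l₁ l₂ l₃ : ℝ, l₁ ≥ l₂ → l₂ ≥ l₃ → l₃ > 0 →
      ∀ R : Matrix.specialOrthogonalGroup (Fin 3) ℝ,
        IsLocalMin (Cosserat.reducedEnergy l₁ l₂ l₃) R →
          ∀ S : Matrix.specialOrthogonalGroup (Fin 3) ℝ,
            Cosserat.reducedEnergy l₁ l₂ l₃ R ≤ Cosserat.reducedEnergy l₁ l₂ l₃ S) ∧
    (∃ l₁ l₂ l₃ : ℝ, l₁ ≥ l₂ ∧ l₂ ≥ l₃ ∧ l₃ > 0 ∧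
      ∃ R : Matrix.specialOrthogonalGroup (Fin 3) ℝ,
        Cosserat.IsNonglobalLocalMax (Cosserat.reducedEnergy l₁ l₂ l₃) R) ∧
    (∀ l₁ l₂ l₃ : ℝ, l₁ > l₂ → l₂ > l₃ → l₃ > 0 →
      ∀ R : Matrix.specialOrthogonalGroup (Fin 3) ℝ,
        ((R : Matrix (Fin 3) (Fin 3) ℝ) = 1 ∧ l₂ + l₃ > 2 ∨
          (R : Matrix (Fin 3) (Fin 3) ℝ) = Matrix.diagonal ![1, -1, -1] ∧ l₁ - l₂ > 2 ∨
          (R : Matrix (Fin 3) (Fin 3) ℝ) = Matrix.diagonal ![-1, 1, -1] ∧ l₂ - l₃ > 2) →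
        Cosserat.IsNonglobalLocalMax (Cosserat.reducedEnergy l₁ l₂ l₃) R) := by
  refine ⟨fun l₁ l₂ l₃ _ _ _ R hR S => Cosserat.reducedEnergy_le_of_isLocalMin hR S,
    ⟨4, 3, 2, by norm_num, by norm_num, by norm_num, 1, ?_⟩,
    fun l₁ l₂ l₃ h₁₂ h₂₃ h₃ R hR => Cosserat.isNonglobalLocalMax_reducedEnergy h₁₂ h₂₃ h₃ hR⟩
  exact Cosserat.isNonglobalLocalMax_reducedEnergy (by norm_num) (by norm_num) (by norm_num)
    (Or.inl ⟨rfl, by norm_num⟩)
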